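/- Conventions. All hypergraphs are finite. The VC-dimension of a graph $G=(V,E)$ is the largest $d\ge 0$ for which there are vertices $a_i$ ($i\in[d]$) and $b_S$ ($S\subseteq[d]$) in $V$ such that, for all $i\in[d]$ and $S\subseteq[d]$, $a_ib_S\in E$ if and only if $i\in S$. For a $3$-uniform hypergraph $H=(V,F)$ and $x\in V$, the slice graph $H_x$ is the graph on $V$ with edge set $\{yz : xyz\in F\}$; the slicewise VC-dimension of $H$ is the maximum over $x\in V$ of the VC-dimension of $H_x$. For nonempty $X,Y,Z\subseteq V$ put $d_H(X,Y,Z)=|\{(x,y,z)\in X\times Y\times Z: \{x,y,z\}\in F\}|/(|X||Y||Z|)$, and call $(X,Y,Z)$ $\epsilon$-homogeneous if $d_H(X,Y,Z)\in[0,\epsilon)\cup(1-\epsilon,1]$. A partition $\mathcal P$ of $V$ is $\epsilon$-homogeneous for $H$ if at least $(1-\epsilon)|V|^3$ of the triples $(x,y,z)\in V^3$ lie in $X\times Y\times Z$ for some $\epsilon$-homogeneous triple $(X,Y,Z)\in\mathcal P^3$. **Theorem 1.4.** For every integer $k\ge 1$ there are real numbers $K,\epsilon^*>0$ such that for every $\epsilon$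 with $0<\epsilon<\epsilon^*$ there is $N\in\mathbb N$ such that every $3$-uniform hypergraph $H$ with at least $N$ vertices and slicewise VC-dimension less than $k$ has an $\epsilon$-homogeneous partition with at most $2^{2^{\epsilon^{-K}}}$ parts. -/

import Mathlib

/-- A 3-uniform hypergraph (3-graph) on the vertex set `V`: a set of 3-element subsets of `V`. -/
structure ThreeGraph (V : Type*) where
  edges : Finset (Finset V)
  card_eq_three : ∀ e ∈ edges, e.card = 3

/-- There are vertices `a i` for `i ∈ [d]` and `b S` for `S ⊆ [d]` such that `a i` and `b S` are
adjacent if and only if `i ∈ S`. -/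
def SimpleGraph.HasShattered {V : Type*} (G : SimpleGraph V) (d : ℕ) : Prop :=
  ∃ (a : Fin d → V) (b : Finset (Fin d) → V),
    ∀ (i : Fin d) (S : Finset (Fin d)), G.Adj (a i) (b S) ↔ i ∈ S

/-- The VC-dimension of a graph: the largest `d` such that `G.HasShattered d`
(the supremum, taken in `ℕ∞`, hence the maximum when `V` is finite and nonempty). -/
noncomputable def SimpleGraph.vcDimension {V : Type*} (G : SimpleGraph V) : ℕ∞ :=
  ⨆ (d : ℕ) (_ : G.HasShattered d), (d : ℕ∞)

namespace ThreeGraph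

/-- The slice graph `H_x`: the graph on all of `V` whose edges are the pairs `yz` with
`xyz` an edge of `H`. -/
def slice {V : Type*} [DecidableEq V] (H : ThreeGraph V) (x : V) : SimpleGraph V where
  Adj y z := y ≠ z ∧ ({x, y, z} : Finset V) ∈ H.edges
  symm := ⟨fun y z h => ⟨h.1.symm, by rw [Finset.pair_comm z y]; exact h.2⟩⟩
  loopless := ⟨fun _ h => h.1 rfl⟩

/-- The slicewise VC-dimension of `H`: the maximum of the VC-dimensions of its slice graphs. -/
noncomputable def slicewiseVC {V : Type*} [DecidableEq V] (H : ThreeGraph V) : ℕ∞ :=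
  ⨆ x : V, (H.slice x).vcDimension

/-- The density `d_H(X, Y, Z)`: the proportion of triples `(x, y, z) ∈ X × Y × Z` such that
`xyz` is an edge of `H`. -/
noncomputable def density {V : Type*} [DecidableEq V] (H : ThreeGraph V)
    (X Y Z : Finset V) : ℝ :=
  (((X ×ˢ Y ×ˢ Z).filter
      fun t : V × V × V => ({t.1, t.2.1, t.2.2} : Finset V) ∈ H.edges).card : ℝ) /
    ((X.card : ℝ) * (Y.card : ℝ) * (Z.card : ℝ))

/-- The triple `(X, Y, Z)` is `ε`-homogeneous: its density lies in `[0, ε) ∪ (1 - ε, 1]`. -/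
def IsHomogeneousTriple {V : Type*} [DecidableEq V] (H : ThreeGraph V) (ε : ℝ)
    (X Y Z : Finset V) : Prop :=
  H.density X Y Z ∈ Set.Ico (0 : ℝ) ε ∪ Set.Ioc (1 - ε) 1

open Classical in
/-- The partition `P` of `V` is `ε`-homogeneous: at least `(1 - ε)|V|³` of the triples
`(x, y, z) ∈ V³` lie in `X × Y × Z` for some `ε`-homogeneous triple `(X, Y, Z)` of parts. -/
def IsHomogeneousPartition {V : Type*} [Fintype V] [DecidableEq V] (H : ThreeGraph V) (ε : ℝ)
    (P : Finpartition (Finset.univ : Finset V)) : Prop :=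
  (1 - ε) * (Fintype.card V : ℝ) ^ 3 ≤
    ((Finset.univ.filter fun t : V × V × V =>
      ∃ X ∈ P.parts, ∃ Y ∈ P.parts, ∃ Z ∈ P.parts,
        H.IsHomogeneousTriple ε X Y Z ∧ t.1 ∈ X ∧ t.2.1 ∈ Y ∧ t.2.2 ∈ Z).card : ℝ)

end ThreeGraph

/-! Two rows that are `η`-far agree on a random sample of `r` points with probability at most `(1 -
η) ^ r`. Bounded VC-dimension allows at most `(r + 1) ^ k` traces on the sample (Sauer–Shelah), so
apart from a few bad rows, equal traces force closeness. Averaging yields one sample serving a whole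
family of relations (`exists_sample`).

This is used twice in `exists_coloring_sliceDist_le`, for the edge relation `T`. A sample `t` in the
third coordinate reduces comparing the slices at `x` and `x'` to comparing the sets `{y | T x y (t
i)}`. By symmetry these are rows of the slice at `t i`, so a second sample `w` controls them.
Coloring `x` by the pairs `(i, j)` with `T x (w j) (t i)` uses `2 ^ L ^ 8` colors, and vertices of
one color have close slices on average.

The parts are the color classes. Resampling the coordinates of a random triple inside their classes
rarely changes membership in `T`, since by symmetry each coordinate costs one average slice distance
(`sum_resampleChange_le`). At a non-homogeneous triple of classes the change has probability at
least `ε`, so Markov's inequality bounds the number of such triples. -/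

/-! ### Traces on a sample and the Sauer–Shelah bound -/

open Finset in
theorem sum_range_pow_le_succ_pow (r k : ℕ) : ∑ i ∈ range k, r ^ i ≤ (r + 1) ^ k := by
  induction k with
  | zero => simp
  | succ k ih =>
    rw [sum_range_succ, pow_succ]
    rcases Nat.eq_zero_or_pos r with rfl | hr
    · rcases Nat.eq_zero_or_pos k with rfl | hk
      · simp
      · simp [hk.ne']
    · have : r ^ k ≤ (r + 1) ^ k * r :=
        (Nat.pow_le_pow_left (Nat.le_succ r) k).trans (Nat.le_mul_of_pos_right _ hr)
      linarith

/-- The sets `{y | R x y}` shatter some indexed set of `k` points. -/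
def RelShatters {X Y : Type*} (R : X → Y → Prop) (k : ℕ) : Prop :=
  ∃ (a : Fin k → Y) (b : Finset (Fin k) → X), ∀ i S, R (b S) (a i) ↔ i ∈ S

open Classical in
/-- The set of indices of the points of the tuple `t` related to `x`. -/
noncomputable def relTrace {X Y : Type*} (R : X → Y → Prop) {r : ℕ} (t : Fin r → Y) (x : X) :
    Finset (Fin r) :=
  Finset.univ.filter fun j => R x (t j)

theorem mem_relTrace {X Y : Type*} {R : X → Y → Prop} {r : ℕ} {t : Fin r → Y} {x : X}
    {j : Fin r} : j ∈ relTrace R t x ↔ R x (t j) := by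
  simp [relTrace]

theorem card_lt_of_shatters_relTrace {X Y : Type*} [Fintype X] {R : X → Y → Prop} {k : ℕ}
    (hR : ¬ RelShatters R k) {r : ℕ} (t : Fin r → Y) {s : Finset (Fin r)}
    (hs : (Finset.univ.image (relTrace R t)).Shatters s) : s.card < k := by
  by_contra! hk
  obtain ⟨s', hs's, hcard⟩ := Finset.exists_subset_card_eq hk
  have hs' := hs.mono_right hs's
  let e : Fin k ↪ Fin r := (s'.orderEmbOfFin hcard).toEmbedding
  have he (i : Fin k) : e i ∈ s' := s'.orderEmbOfFin_mem hcard i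
  have key (S : Finset (Fin k)) : ∃ x, s' ∩ relTrace R t x = S.map e := by
    obtain ⟨u, hu, hsu⟩ := hs' (t := S.map e) (by
      intro j hj
      obtain ⟨i, -, rfl⟩ := Finset.mem_map.1 hj
      exact he i)
    obtain ⟨x, -, rfl⟩ := Finset.mem_image.1 hu
    exact ⟨x, hsu⟩
  choose b hb using key
  refine hR ⟨fun i => t (e i), b, fun i S => ?_⟩
  have := congrArg (e i ∈ ·) (hb S)
  simpa [he i, mem_relTrace] using this

theorem card_image_relTrace_le {X Y : Type*} [Fintype X] {R : X → Y → Prop} {k : ℕ}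
    (hk : 0 < k) (hR : ¬ RelShatters R k) {r : ℕ} (t : Fin r → Y) :
    (Finset.univ.image (relTrace R t)).card ≤ (r + 1) ^ k := by
  set A := Finset.univ.image (relTrace R t) with hA
  have hd : A.vcDim < k := by
    rw [Finset.vcDim, Finset.sup_lt_iff (by simpa using hk)]
    intro s hs
    exact card_lt_of_shatters_relTrace hR t (Finset.mem_shatterer.1 hs)
  calc A.card ≤ A.shatterer.card := A.card_le_card_shatterer
    _ ≤ ∑ i ∈ Finset.Iic A.vcDim, (Fintype.card (Fin r)).choose i :=
        Finset.card_shatterer_le_sum_vcDim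
    _ ≤ ∑ i ∈ Finset.range k, r ^ i := by
        refine (Finset.sum_le_sum_of_subset (f := fun i => (Fintype.card (Fin r)).choose i)
          (t := Finset.range k) ?_).trans (Finset.sum_le_sum fun i _ => ?_)
        · intro i hi
          simp only [Finset.mem_Iic, Finset.mem_range] at *
          omega
        · simpa using Nat.choose_le_pow r i
    _ ≤ (r + 1) ^ k := sum_range_pow_le_succ_pow r k

/-! ### Distance between rows -/

open Classical in
/-- The indicator of `p` and `q` having different truth values. -/
noncomputable def disagree (p q : Prop) : ℝ := if (p ↔ q) then 0 else 1

theorem disagree_nonneg (p q : Prop) : 0 ≤ disagree p q := by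
  unfold disagree; split_ifs <;> norm_num

theorem disagree_le_one (p q : Prop) : disagree p q ≤ 1 := by
  unfold disagree; split_ifs <;> norm_num

theorem disagree_of_iff {p q : Prop} (h : p ↔ q) : disagree p q = 0 := if_pos h

theorem disagree_of_not_iff {p q : Prop} (h : ¬ (p ↔ q)) : disagree p q = 1 := if_neg h

theorem disagree_comm (p q : Prop) : disagree p q = disagree q p := by
  unfold disagree; by_cases p <;> by_cases q <;> simp [*]

theorem disagree_triangle (p q r : Prop) : disagree p r ≤ disagree p q + disagree q r := by
  unfold disagree
  by_cases p <;> by_cases q <;> by_cases r <;> simp [*]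

/-- The number of points on which the rows of `x` and `x'` differ. -/
noncomputable def rowDist {X Y : Type*} [Fintype Y] (R : X → Y → Prop) (x x' : X) : ℝ :=
  ∑ y, disagree (R x y) (R x' y)

section rowDist

variable {X Y : Type*} [Fintype Y] (R : X → Y → Prop)

theorem rowDist_comm (x x' : X) : rowDist R x x' = rowDist R x' x := by
  exact Finset.sum_congr rfl fun y _ => disagree_comm _ _

theorem rowDist_triangle (x x' x'' : X) :
    rowDist R x x'' ≤ rowDist R x x' + rowDist R x' x'' := by
  rw [rowDist, rowDist, rowDist, ← Finset.sum_add_distrib]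
  exact Finset.sum_le_sum fun y _ => disagree_triangle _ _ _

theorem rowDist_le_card (x x' : X) : rowDist R x x' ≤ Fintype.card Y := by
  refine (Finset.sum_le_sum fun y _ => disagree_le_one _ _).trans ?_
  simp

open Classical in
theorem card_agree_add_rowDist (x x' : X) :
    ((Finset.univ.filter fun y => (R x y ↔ R x' y)).card : ℝ) + rowDist R x x'
      = Fintype.card Y := by
  rw [Finset.card_filter, Nat.cast_sum, rowDist, ← Finset.sum_add_distrib]
  rw [← Finset.card_univ, Finset.card_eq_sum_ones, Nat.cast_sum]
  refine Finset.sum_congr rfl fun y _ => ?_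
  unfold disagree
  split_ifs <;> simp

open Classical in
-- The entries of the tuple are chosen independently among the points where the two rows agree.
theorem card_relTrace_eq (r : ℕ) (x x' : X) :
    ((Finset.univ.filter fun t : Fin r → Y => relTrace R t x = relTrace R t x').card : ℝ)
      = (Fintype.card Y - rowDist R x x') ^ r := by
  rw [← card_agree_add_rowDist R x x', add_sub_cancel_right, ← Nat.cast_pow]
  congr 1
  have : (Finset.univ.filter fun t : Fin r → Y => relTrace R t x = relTrace R t x')
      = Fintype.piFinset fun _ : Fin r => Finset.univ.filter fun y => (R x y ↔ R x' y) := by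
    ext t
    simp [Finset.ext_iff, mem_relTrace]
  rw [this, Fintype.card_piFinset]
  simp

end rowDist

/-! ### Random samples and bad rows -/

section badRow

open Finset

variable {X Y : Type*} [Fintype X] [Fintype Y]

open Classical in
/-- The elements with the same trace as `x` on `t`. -/
noncomputable def traceClass (R : X → Y → Prop) {r : ℕ} (t : Fin r → Y) (x : X) : Finset X :=
  univ.filter fun x' => relTrace R t x = relTrace R t x'

open Classical in
/-- The elements with the same trace as `x` on `t` whose row is nevertheless `η`-far from that
of `x`. -/
noncomputable def farClass (R : X → Y → Prop) (η : ℝ) {r : ℕ} (t : Fin r → Y) (x : X) :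
    Finset X :=
  (traceClass R t x).filter fun x' => η * Fintype.card Y ≤ rowDist R x x'

/-- At least half of the trace class of `x` is far from `x`. -/
def IsBadRow (R : X → Y → Prop) (η : ℝ) {r : ℕ} (t : Fin r → Y) (x : X) : Prop :=
  (traceClass R t x).card ≤ 2 * (farClass R η t x).card

/-- The two far sets each fill less than half of the common trace class, so some `w` in it is close
to both rows. -/
theorem rowDist_le_of_not_isBadRow {R : X → Y → Prop} {η : ℝ} {r : ℕ} {t : Fin r → Y}
    {x x' : X} (hx : ¬ IsBadRow R η t x) (hx' : ¬ IsBadRow R η t x')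
    (h : relTrace R t x = relTrace R t x') :
    rowDist R x x' ≤ 2 * η * Fintype.card Y := by
  classical
  unfold IsBadRow at hx hx'
  have hcls : traceClass R t x' = traceClass R t x := by simp only [traceClass, h]
  rw [hcls] at hx'
  have hne : ¬ traceClass R t x ⊆ farClass R η t x ∪ farClass R η t x' := by
    intro hsub
    have := (card_le_card hsub).trans (card_union_le _ _)
    omega
  obtain ⟨w, hw, hw'⟩ := not_subset.1 hne
  have hw₂ : w ∈ traceClass R t x' := hcls ▸ hw
  simp only [farClass, mem_union, mem_filter, hw, hw₂, true_and, not_or, not_le] at hw'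
  have := rowDist_triangle R x w x'
  rw [rowDist_comm R w x'] at this
  linarith [hw'.1, hw'.2]

open Classical in
-- Cauchy–Schwarz over the trace classes: squaring the bad count in each class counts pairs, and
-- badness bounds these by far pairs with equal trace.
theorem card_isBadRow_sq_le (R : X → Y → Prop) (η : ℝ) {r : ℕ} (t : Fin r → Y) :
    (univ.filter (IsBadRow R η t)).card ^ 2 ≤
      2 * (univ.image (relTrace R t)).card * ∑ x, (farClass R η t x).card := by
  set B := univ.filter (IsBadRow R η t) with hB
  set Q := univ.image (relTrace R t) with hQ
  have hmaps : ∀ x ∈ B, relTrace R t x ∈ Q := fun x _ => mem_image_of_mem _ (mem_univ x)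
  calc B.card ^ 2 = (∑ c ∈ Q, (B.filter fun x => relTrace R t x = c).card) ^ 2 := by
        rw [← card_eq_sum_card_fiberwise hmaps]
    _ ≤ Q.card * ∑ c ∈ Q, (B.filter fun x => relTrace R t x = c).card ^ 2 :=
        sq_sum_le_card_mul_sum_sq
    _ ≤ Q.card * ∑ c ∈ Q, ∑ x ∈ B.filter (fun x => relTrace R t x = c),
          2 * (farClass R η t x).card := by
        refine Nat.mul_le_mul_left _ (sum_le_sum fun c _ => ?_)
        rw [sq, ← smul_eq_mul, ← sum_const]
        refine sum_le_sum fun x hx => ?_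
        rw [mem_filter] at hx
        refine le_trans (card_le_card fun w hw => ?_) (mem_filter.1 hx.1).2
        simp only [traceClass, mem_filter, mem_univ, true_and] at hw ⊢
        rw [hx.2, hw.2]
    _ = Q.card * ∑ x ∈ B, 2 * (farClass R η t x).card := by
        rw [sum_fiberwise_of_maps_to hmaps]
    _ ≤ Q.card * ∑ x, 2 * (farClass R η t x).card :=
        Nat.mul_le_mul_left _ (sum_le_sum_of_subset (subset_univ _))
    _ = _ := by rw [← mul_sum]; ring

theorem sum_card_farClass_le (R : X → Y → Prop) {η : ℝ} (hη : η ≤ 1) (r : ℕ) :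
    ∑ t : Fin r → Y, ∑ x, ((farClass R η t x).card : ℝ) ≤
      (Fintype.card X : ℝ) ^ 2 * ((1 - η) ^ r * (Fintype.card Y : ℝ) ^ r) := by
  classical
  have hpair (x x' : X) : ∑ t : Fin r → Y, (if x' ∈ farClass R η t x then (1 : ℝ) else 0) ≤
      (1 - η) ^ r * (Fintype.card Y : ℝ) ^ r := by
    have h0 : 0 ≤ (1 - η) ^ r * (Fintype.card Y : ℝ) ^ r := by
      have : 0 ≤ 1 - η := by linarith
      positivity
    by_cases hfar : η * Fintype.card Y ≤ rowDist R x x'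
    · simp only [farClass, traceClass, mem_filter, mem_univ, true_and, hfar, and_true]
      rw [sum_boole, card_relTrace_eq, ← mul_pow]
      exact pow_le_pow_left₀ (by linarith [rowDist_le_card R x x']) (by linarith) r
    · simpa [farClass, hfar] using h0
  calc ∑ t : Fin r → Y, ∑ x, ((farClass R η t x).card : ℝ)
      = ∑ x, ∑ x', ∑ t : Fin r → Y, (if x' ∈ farClass R η t x then (1 : ℝ) else 0) := by
        rw [sum_comm]
        refine sum_congr rfl fun x _ => ?_
        rw [sum_comm]
        simp
    _ ≤ ∑ _x : X, ∑ _x' : X, (1 - η) ^ r * (Fintype.card Y : ℝ) ^ r :=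
        sum_le_sum fun x _ => sum_le_sum fun x' _ => hpair x x'
    _ = _ := by simp only [sum_const, card_univ, nsmul_eq_mul]; ring

open Classical in
/-- A common sample on which almost all rows are good. -/
theorem exists_sum_card_isBadRow_le {I : Type*} [Fintype I] [Nonempty Y]
    {R : I → X → Y → Prop} {k : ℕ} (hk : 0 < k) (hR : ∀ i, ¬ RelShatters (R i) k)
    {η : ℝ} (hη₀ : 0 ≤ η) (hη : η ≤ 1) {r : ℕ}
    (hr : 2 * ((r : ℝ) + 1) ^ k * (1 - η) ^ r ≤ η ^ 2) :
    ∃ t : Fin r → Y, ∑ i, ((univ.filter (IsBadRow (R i) η t)).card : ℝ) ≤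
      η * (Fintype.card X * Fintype.card I) := by
  have hone (i : I) (t : Fin r → Y) : ((univ.filter (IsBadRow (R i) η t)).card : ℝ) ^ 2 ≤
      2 * ((r : ℝ) + 1) ^ k * ∑ x, ((farClass (R i) η t x).card : ℝ) := by
    have h₁ := card_isBadRow_sq_le (R i) η t
    have h₂ := card_image_relTrace_le hk (hR i) t
    have h₃ := h₁.trans (Nat.mul_le_mul_right _ (Nat.mul_le_mul_left 2 h₂))
    exact_mod_cast h₃
  have hsum : ∑ t : Fin r → Y, ∑ i, ((univ.filter (IsBadRow (R i) η t)).card : ℝ) ^ 2 ≤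
      ∑ _t : Fin r → Y, η ^ 2 * ((Fintype.card X : ℝ) ^ 2 * Fintype.card I) := by
    calc ∑ t : Fin r → Y, ∑ i, ((univ.filter (IsBadRow (R i) η t)).card : ℝ) ^ 2
        ≤ ∑ t : Fin r → Y, ∑ i,
            2 * ((r : ℝ) + 1) ^ k * ∑ x, ((farClass (R i) η t x).card : ℝ) :=
          sum_le_sum fun t _ => sum_le_sum fun i _ => hone i t
      _ = ∑ i, 2 * ((r : ℝ) + 1) ^ k *
            ∑ t : Fin r → Y, ∑ x, ((farClass (R i) η t x).card : ℝ) := by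
          rw [sum_comm]
          simp only [mul_sum]
      _ ≤ ∑ _i : I, 2 * ((r : ℝ) + 1) ^ k *
            ((Fintype.card X : ℝ) ^ 2 * ((1 - η) ^ r * (Fintype.card Y : ℝ) ^ r)) :=
          sum_le_sum fun i _ =>
            mul_le_mul_of_nonneg_left (sum_card_farClass_le (R i) hη r) (by positivity)
      _ = (2 * ((r : ℝ) + 1) ^ k * (1 - η) ^ r) *
            ((Fintype.card I : ℝ) * (Fintype.card X : ℝ) ^ 2 * (Fintype.card Y : ℝ) ^ r) := by
          simp only [sum_const, card_univ, nsmul_eq_mul]; ring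
      _ ≤ η ^ 2 *
            ((Fintype.card I : ℝ) * (Fintype.card X : ℝ) ^ 2 * (Fintype.card Y : ℝ) ^ r) :=
          mul_le_mul_of_nonneg_right hr (by positivity)
      _ = _ := by
          simp only [sum_const, card_univ, nsmul_eq_mul, Fintype.card_fun, Fintype.card_fin,
            Nat.cast_pow]
          ring
  -- Averaging the sum over `i`, rather than a union bound, lets one `t` serve all `i` with `r`
  -- independent of `I`.
  obtain ⟨t, -, ht⟩ := exists_le_of_sum_le univ_nonempty hsum
  refine ⟨t, abs_le_of_sq_le_sq' ?_ (by positivity) |>.2⟩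
  calc (∑ i, ((univ.filter (IsBadRow (R i) η t)).card : ℝ)) ^ 2
      ≤ Fintype.card I * ∑ i, ((univ.filter (IsBadRow (R i) η t)).card : ℝ) ^ 2 :=
        sq_sum_le_card_mul_sum_sq
    _ ≤ Fintype.card I * (η ^ 2 * ((Fintype.card X : ℝ) ^ 2 * Fintype.card I)) :=
        mul_le_mul_of_nonneg_left ht (by positivity)
    _ = _ := by ring

/-- A common sample `t` controlling, up to a small error `b`, the distance of any two rows by
their disagreements on `t`. -/
theorem exists_sample {I : Type*} [Fintype I] [Nonempty Y]
    {R : I → X → Y → Prop} {k : ℕ} (hk : 0 < k) (hR : ∀ i, ¬ RelShatters (R i) k)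
    {η : ℝ} (hη₀ : 0 ≤ η) (hη : η ≤ 1) {r : ℕ}
    (hr : 2 * ((r : ℝ) + 1) ^ k * (1 - η) ^ r ≤ η ^ 2) :
    ∃ (t : Fin r → Y) (b : I → X → ℝ),
      ∑ i, ∑ x, b i x ≤ η * (Fintype.card X * Fintype.card I) ∧
      ∀ i x x', rowDist (R i) x x' ≤ Fintype.card Y *
        (2 * η + b i x + b i x' + ∑ j, disagree (R i x (t j)) (R i x' (t j))) := by
  classical
  obtain ⟨t, ht⟩ := exists_sum_card_isBadRow_le hk hR hη₀ hη hr
  refine ⟨t, fun i x => if IsBadRow (R i) η t x then 1 else 0, ?_, fun i x x' => ?_⟩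
  · simpa only [sum_boole] using ht
  have hb (x : X) : (0 : ℝ) ≤ if IsBadRow (R i) η t x then 1 else 0 := by split_ifs <;> simp
  have hs : 0 ≤ ∑ j, disagree (R i x (t j)) (R i x' (t j)) :=
    sum_nonneg fun _ _ => disagree_nonneg _ _
  have hY : (0 : ℝ) ≤ Fintype.card Y := by positivity
  by_cases hgood : (¬ IsBadRow (R i) η t x ∧ ¬ IsBadRow (R i) η t x') ∧
      relTrace (R i) t x = relTrace (R i) t x'
  · have := rowDist_le_of_not_isBadRow hgood.1.1 hgood.1.2 hgood.2
    beta_reduce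
    rw [if_neg hgood.1.1, if_neg hgood.1.2]
    nlinarith
  -- Otherwise a bad row or a disagreement on `t` contributes at least 1 to the bracket, so the
  -- trivial bound suffices.
  · refine (rowDist_le_card _ x x').trans (le_mul_of_one_le_right hY ?_)
    beta_reduce
    by_cases hx : IsBadRow (R i) η t x
    · have := hb x'
      rw [if_pos hx]
      linarith
    by_cases hx' : IsBadRow (R i) η t x'
    · have := hb x
      rw [if_pos hx']
      linarith
    have hne : relTrace (R i) t x ≠ relTrace (R i) t x' := fun h => hgood ⟨⟨hx, hx'⟩, h⟩
    obtain ⟨j, hj⟩ : ∃ j, ¬ (R i x (t j) ↔ R i x' (t j)) := by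
      by_contra! h
      exact hne (Finset.ext fun j => by simpa only [mem_relTrace] using h j)
    have h₁ : disagree (R i x (t j)) (R i x' (t j)) ≤
        ∑ j, disagree (R i x (t j)) (R i x' (t j)) :=
      single_le_sum (f := fun j => disagree (R i x (t j)) (R i x' (t j)))
        (fun _ _ => disagree_nonneg _ _) (mem_univ j)
    rw [disagree_of_not_iff hj] at h₁
    have := hb x
    have := hb x'
    linarith

end badRow

/-- The sample size `L ^ 2` suffices for precision `1 / L` when `L` is large. -/
theorem eventually_sample_size (k : ℕ) : ∀ᶠ L : ℕ in Filter.atTop,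
    2 * (((L ^ 2 : ℕ) : ℝ) + 1) ^ k * (1 - 1 / (L : ℝ)) ^ (L ^ 2) ≤ (1 / (L : ℝ)) ^ 2 := by
  -- The exponent is `2 * k` from `(L ^ 2 + 1) ^ k ≤ 2 ^ k * L ^ (2 * k)`, plus 2 from the target
  -- `(1 / L) ^ 2`; `c` cancels the constants.
  have h := (Real.isLittleO_pow_exp_atTop (n := 2 * k + 2)).def (c := 1 / (2 * 2 ^ k)) (by positivity)
  have h' := tendsto_natCast_atTop_atTop (R := ℝ) |>.eventually h
  filter_upwards [h', Filter.eventually_ge_atTop 1] with L hL hL1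
  have hL1' : (1 : ℝ) ≤ L := by exact_mod_cast hL1
  have hL0 : (0 : ℝ) < L := by linarith
  rw [Real.norm_of_nonneg (by positivity), Real.norm_of_nonneg (Real.exp_pos _).le] at hL
  have h₂ : 0 ≤ 1 - 1 / (L : ℝ) := by
    rw [sub_nonneg, div_le_one hL0]; exact hL1'
  have hexp : (1 - 1 / (L : ℝ)) ^ (L ^ 2) ≤ Real.exp (-L) := by
    have h₁ : 1 - 1 / (L : ℝ) ≤ Real.exp (-(1 / L)) := by
      linarith [Real.add_one_le_exp (-(1 / (L : ℝ)))]
    refine (pow_le_pow_left₀ h₂ h₁ _).trans_eq ?_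
    rw [← Real.exp_nat_mul]
    congr 1
    push_cast
    field_simp
  have hbase : (((L ^ 2 : ℕ) : ℝ) + 1) ^ k ≤ 2 ^ k * (L : ℝ) ^ (2 * k) := by
    rw [pow_mul, ← mul_pow]
    refine pow_le_pow_left₀ (by positivity) ?_ _
    push_cast
    nlinarith
  calc 2 * (((L ^ 2 : ℕ) : ℝ) + 1) ^ k * (1 - 1 / (L : ℝ)) ^ (L ^ 2)
      ≤ 2 * (2 ^ k * (L : ℝ) ^ (2 * k)) * Real.exp (-L) :=
        mul_le_mul (by gcongr) hexp (pow_nonneg h₂ _) (by positivity)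
    _ = (2 * 2 ^ k * (L : ℝ) ^ (2 * k + 2)) * Real.exp (-L) * (1 / (L : ℝ)) ^ 2 := by
        rw [pow_add]; field_simp
    _ ≤ 1 * (1 / (L : ℝ)) ^ 2 := by
        refine mul_le_mul_of_nonneg_right ?_ (by positivity)
        rw [Real.exp_neg, ← div_eq_mul_inv, div_le_one (Real.exp_pos _)]
        calc 2 * 2 ^ k * (L : ℝ) ^ (2 * k + 2)
            ≤ 2 * 2 ^ k * (1 / (2 * 2 ^ k) * Real.exp L) := by gcongr
          _ = Real.exp L := by field_simp
    _ = _ := one_mul _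

/-! ### Coloring the vertices by two nested samples -/

section ternary

open Finset

variable {V : Type*} [Fintype V]

/-- The number of pairs on which the slices of a ternary relation at `x` and `x'` differ. -/
noncomputable def sliceDist (T : V → V → V → Prop) (x x' : V) : ℝ :=
  ∑ y, ∑ z, disagree (T x y z) (T x' y z)

/-- A symmetric ternary relation all of whose slices have small VC-dimension admits a coloring
with few colors such that vertices of the same color have close slices on average. -/
theorem exists_coloring_sliceDist_le [Nonempty V] {T : V → V → V → Prop}
    (h₁ : ∀ x y z, T x y z ↔ T y x z) (h₂ : ∀ x y z, T x y z ↔ T x z y)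
    {k : ℕ} (hk : 0 < k) (hT : ∀ x, ¬ RelShatters (T x) k) {L : ℕ} (hL : 1 ≤ L)
    (hs : 2 * (((L ^ 2 : ℕ) : ℝ) + 1) ^ k * (1 - 1 / (L : ℝ)) ^ (L ^ 2) ≤ (1 / (L : ℝ)) ^ 2)
    (hs' : 2 * ((((L ^ 3) ^ 2 : ℕ) : ℝ) + 1) ^ k * (1 - 1 / ((L ^ 3 : ℕ) : ℝ)) ^ ((L ^ 3) ^ 2) ≤
      (1 / ((L ^ 3 : ℕ) : ℝ)) ^ 2) :
    ∃ (f : V → Finset (Fin (L ^ 2) × Fin ((L ^ 3) ^ 2))) (c : V → ℝ),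
      ∑ x, c x ≤ 2 * (Fintype.card V : ℝ) ^ 2 / L ∧
      ∀ x x', f x = f x' → sliceDist T x x' ≤
        Fintype.card V * (4 * Fintype.card V / L + c x + c x') := by
  classical
  have hL' : (1 : ℝ) ≤ L := by exact_mod_cast hL
  have hL0 : (0 : ℝ) < L := by linarith
  have hL3 : (1 : ℝ) ≤ ((L ^ 3 : ℕ) : ℝ) := by exact_mod_cast Nat.one_le_pow _ _ hL
  obtain ⟨t, b, hb, hd⟩ := exists_sample (R := fun y x z => T x y z) hk (fun y => by
    have : (fun x z => T x y z) = T y := by ext x z; exact h₁ x y z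
    rw [this]; exact hT y) (by positivity) (by rwa [div_le_one hL0]) hs
  -- Errors add up over `L ^ 2` relations, so precision `1 / L ^ 3` is needed for a total of order
  -- `1 / L`.
  obtain ⟨w, b', hb', hd'⟩ := exists_sample (R := fun i x y => T x y (t i)) hk (fun i => by
    have : (fun x y => T x y (t i)) = T (t i) := by
      ext x y; rw [h₂ x y, h₁ x]
    rw [this]; exact hT (t i)) (by positivity) (by rwa [div_le_one (by linarith)]) hs'
  refine ⟨fun x => univ.filter fun p => T x (w p.2) (t p.1),
    fun x => ∑ y, b y x + Fintype.card V * ∑ i, b' i x, ?_, fun x x' hf => ?_⟩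
  · rw [sum_add_distrib, ← mul_sum, sum_comm, sum_comm (f := fun x i => b' i x)]
    simp only [Fintype.card_fin] at hb'
    calc _ ≤ 1 / (L : ℝ) * (Fintype.card V * Fintype.card V) + Fintype.card V *
          (1 / ((L ^ 3 : ℕ) : ℝ) * (Fintype.card V * ((L ^ 2 : ℕ) : ℝ))) := by gcongr
      _ = _ := by push_cast; field_simp; ring
  · have hzero (i) (j) : disagree (T x (w j) (t i)) (T x' (w j) (t i)) = 0 := by
      refine disagree_of_iff ?_
      have := Finset.ext_iff.1 hf (i, j)
      simpa using this
    have hd₂ (i) : rowDist (fun x y => T x y (t i)) x x' ≤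
        Fintype.card V * (2 * (1 / ((L ^ 3 : ℕ) : ℝ)) + b' i x + b' i x') := by
      simpa only [hzero, sum_const_zero, add_zero] using hd' i x x'
    calc sliceDist T x x' = ∑ y, rowDist (fun x z => T x y z) x x' := rfl
      _ ≤ ∑ y, Fintype.card V * (2 * (1 / (L : ℝ)) + b y x + b y x' +
            ∑ i, disagree (T x y (t i)) (T x' y (t i))) := sum_le_sum fun y _ => hd y x x'
      -- Exchanging the sums over `y` and `i` turns disagreements on `t` into row distances, to
      -- which the second sample applies.
      _ = Fintype.card V * (Fintype.card V * (2 * (1 / (L : ℝ))) + ∑ y, b y x + ∑ y, b y x' +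
            ∑ i, rowDist (fun x y => T x y (t i)) x x') := by
          simp only [rowDist]
          rw [← mul_sum, sum_add_distrib, sum_add_distrib, sum_add_distrib, sum_const,
            card_univ, nsmul_eq_mul, sum_comm]
      _ ≤ Fintype.card V * (Fintype.card V * (2 * (1 / (L : ℝ))) + ∑ y, b y x + ∑ y, b y x' +
            ∑ i, Fintype.card V * (2 * (1 / ((L ^ 3 : ℕ) : ℝ)) + b' i x + b' i x')) := by
          gcongr with i; exact hd₂ i
      _ = _ := by
          rw [← mul_sum, sum_add_distrib, sum_add_distrib, sum_const,
            card_univ, nsmul_eq_mul, Fintype.card_fin]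
          push_cast
          field_simp
          ring

/-! ### Resampling inside color classes -/

/-- The transition kernel which moves `x` to a uniformly random element of its color class. -/
noncomputable def colorKernel {C : Type*} [DecidableEq C] (f : V → C) (x x' : V) : ℝ :=
  if f x = f x' then ((univ.filter fun w => f x = f w).card : ℝ)⁻¹ else 0

section colorKernel

variable {C : Type*} [DecidableEq C] (f : V → C)

theorem colorKernel_nonneg (x x' : V) : 0 ≤ colorKernel f x x' := by
  unfold colorKernel; split_ifs <;> positivity

theorem colorKernel_comm (x x' : V) : colorKernel f x x' = colorKernel f x' x := by
  unfold colorKernel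
  by_cases h : f x = f x'
  · simp [h]
  · simp [h, Ne.symm h]

theorem sum_colorKernel_mul (x : V) (g : V → ℝ) :
    ∑ x', colorKernel f x x' * g x' = (∑ x' ∈ univ.filter (fun w => f x = f w), g x') /
      (univ.filter fun w => f x = f w).card := by
  simp only [colorKernel, ite_mul, zero_mul]
  rw [← sum_filter, ← mul_sum, inv_mul_eq_div]

theorem sum_colorKernel (x : V) : ∑ x', colorKernel f x x' = 1 := by
  have hne : ((univ.filter fun w => f x = f w).card : ℝ) ≠ 0 :=
    Nat.cast_ne_zero.2 (card_ne_zero.2 ⟨x, by simp⟩)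
  have := sum_colorKernel_mul f x fun _ => 1
  simpa [hne] using this

theorem sum_colorKernel_left (x' : V) : ∑ x, colorKernel f x x' = 1 := by
  simp only [colorKernel_comm f _ x', sum_colorKernel]

theorem sum_colorKernel_mul_sliceDist_le {T : V → V → V → Prop} {c : V → ℝ} {A B n : ℝ}
    (hn : 0 ≤ n) (hc : ∑ x, c x ≤ B)
    (hd : ∀ x x', f x = f x' → sliceDist T x x' ≤ n * (A + c x + c x')) :
    ∑ x, ∑ x', colorKernel f x x' * sliceDist T x x' ≤
      n * (A * Fintype.card V + 2 * B) := by
  calc ∑ x, ∑ x', colorKernel f x x' * sliceDist T x x'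
      ≤ ∑ x, ∑ x', colorKernel f x x' * (n * (A + c x + c x')) := by
        refine sum_le_sum fun x _ => sum_le_sum fun x' _ => ?_
        by_cases h : f x = f x'
        · exact mul_le_mul_of_nonneg_left (hd x x' h) (colorKernel_nonneg f x x')
        · simp [colorKernel, h]
    _ = n * (∑ x, (A + c x) * ∑ x', colorKernel f x x' +
          ∑ x', c x' * ∑ x, colorKernel f x x') := by
        have : ∑ x', c x' * ∑ x, colorKernel f x x' = ∑ x, ∑ x', c x' * colorKernel f x x' := by
          rw [sum_comm]; simp only [mul_sum]
        rw [this, ← sum_add_distrib, mul_sum]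
        refine sum_congr rfl fun x _ => ?_
        rw [mul_sum, ← sum_add_distrib, mul_sum]
        exact sum_congr rfl fun x' _ => by ring
    _ = n * (A * Fintype.card V + 2 * ∑ x, c x) := by
        simp only [sum_colorKernel, sum_colorKernel_left, mul_one, sum_add_distrib, sum_const,
          card_univ, nsmul_eq_mul]
        ring
    _ ≤ _ := by gcongr

/-- The probability that resampling all three coordinates inside their color classes changes
membership in `T`. -/
noncomputable def resampleChange (T : V → V → V → Prop) (x y z : V) : ℝ :=
  ∑ x', colorKernel f x x' * ∑ y', colorKernel f y y' * ∑ z', colorKernel f z z' *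
    disagree (T x y z) (T x' y' z')

/-- Hybrid argument: replace the coordinates one at a time; coordinates not involved in a step
integrate out. -/
theorem resampleChange_le (T : V → V → V → Prop) (x y z : V) :
    resampleChange f T x y z ≤
      (∑ x', colorKernel f x x' * disagree (T x y z) (T x' y z)) +
      (∑ x', colorKernel f x x' * ∑ y', colorKernel f y y' *
        disagree (T x' y z) (T x' y' z)) +
      ∑ x', colorKernel f x x' * ∑ y', colorKernel f y y' * ∑ z', colorKernel f z z' *
        disagree (T x' y' z) (T x' y' z') := by
  rw [← sum_add_distrib, ← sum_add_distrib]
  refine sum_le_sum fun x' _ => ?_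
  rw [← mul_add, ← mul_add]
  refine mul_le_mul_of_nonneg_left ?_ (colorKernel_nonneg f x x')
  have h₁ : disagree (T x y z) (T x' y z) =
      ∑ y', colorKernel f y y' * disagree (T x y z) (T x' y z) := by
    rw [← sum_mul, sum_colorKernel, one_mul]
  rw [h₁, ← sum_add_distrib, ← sum_add_distrib]
  refine sum_le_sum fun y' _ => ?_
  rw [← mul_add, ← mul_add]
  refine mul_le_mul_of_nonneg_left ?_ (colorKernel_nonneg f y y')
  have h₂ (a : ℝ) : a = ∑ z', colorKernel f z z' * a := by
    rw [← sum_mul, sum_colorKernel, one_mul]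
  rw [h₂ (disagree (T x y z) (T x' y z) + disagree (T x' y z) (T x' y' z)), ← sum_add_distrib]
  refine sum_le_sum fun z' _ => ?_
  rw [← mul_add]
  refine mul_le_mul_of_nonneg_left ?_ (colorKernel_nonneg f z z')
  linarith [disagree_triangle (T x y z) (T x' y z) (T x' y' z'),
    disagree_triangle (T x' y z) (T x' y' z) (T x' y' z')]

theorem resampleChange_nonneg (T : V → V → V → Prop) (x y z : V) :
    0 ≤ resampleChange f T x y z :=
  sum_nonneg fun _ _ => mul_nonneg (colorKernel_nonneg f _ _) <|
    sum_nonneg fun _ _ => mul_nonneg (colorKernel_nonneg f _ _) <|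
      sum_nonneg fun _ _ => mul_nonneg (colorKernel_nonneg f _ _) (disagree_nonneg _ _)

/-- The kernel is doubly stochastic, so coordinates already resampled are again uniform; symmetry of
`T` then makes each of the three hybrid steps equal to the same average slice distance. -/
theorem sum_resampleChange_le {T : V → V → V → Prop}
    (h₁ : ∀ x y z, T x y z ↔ T y x z) (h₂ : ∀ x y z, T x y z ↔ T x z y) :
    ∑ x, ∑ y, ∑ z, resampleChange f T x y z ≤
      3 * ∑ x, ∑ x', colorKernel f x x' * sliceDist T x x' := by
  have avg (g : V → ℝ) : ∑ x, ∑ x', colorKernel f x x' * g x' = ∑ x', g x' := by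
    rw [sum_comm]
    simp only [← sum_mul, sum_colorKernel_left, one_mul]
  have avg₂ (g : V → V → ℝ) :
      ∑ x, ∑ y, ∑ x', colorKernel f x x' * g x' y = ∑ x, ∑ y, g x y := by
    rw [← avg fun x => ∑ y, g x y]
    refine sum_congr rfl fun x _ => ?_
    simp only [mul_sum]
    rw [sum_comm]
  have avg₃ (g : V → V → V → ℝ) :
      ∑ x, ∑ y, ∑ z, ∑ x', colorKernel f x x' * g x' y z = ∑ x, ∑ y, ∑ z, g x y z := by
    rw [sum_comm, sum_comm (f := fun x y => ∑ z, g x y z)]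
    exact sum_congr rfl fun y _ => avg₂ fun x z => g x y z
  set S := ∑ x, ∑ x', colorKernel f x x' * sliceDist T x x' with hS
  have e₁ : ∑ x, ∑ y, ∑ z, ∑ x', colorKernel f x x' * disagree (T x y z) (T x' y z) = S := by
    rw [hS]
    refine sum_congr rfl fun x _ => ?_
    simp only [sliceDist, mul_sum]
    rw [eq_comm, sum_comm]
    refine sum_congr rfl fun y _ => ?_
    rw [sum_comm]
  have e₂ : ∑ x, ∑ y, ∑ z, ∑ x', colorKernel f x x' * ∑ y', colorKernel f y y' *
      disagree (T x' y z) (T x' y' z) = S := by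
    rw [avg₃ fun x y z => ∑ y', colorKernel f y y' * disagree (T x y z) (T x y' z), sum_comm,
      ← e₁]
    refine sum_congr rfl fun y _ => sum_congr rfl fun x _ => sum_congr rfl fun z _ =>
      sum_congr rfl fun y' _ => ?_
    rw [propext (h₁ x y z), propext (h₁ x y' z)]
  have e₃ : ∑ x, ∑ y, ∑ z, ∑ x', colorKernel f x x' * ∑ y', colorKernel f y y' *
      ∑ z', colorKernel f z z' * disagree (T x' y' z) (T x' y' z') = S := by
    rw [avg₃ fun x y z => ∑ y', colorKernel f y y' *
      ∑ z', colorKernel f z z' * disagree (T x y' z) (T x y' z')]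
    calc _ = ∑ x, ∑ y, ∑ z, ∑ z', colorKernel f z z' * disagree (T x y z) (T x y z') :=
          sum_congr rfl fun x _ => avg₂ fun y z =>
            ∑ z', colorKernel f z z' * disagree (T x y z) (T x y z')
      _ = ∑ x, ∑ z, ∑ y, ∑ z', colorKernel f z z' * disagree (T z x y) (T z' x y) := by
          refine sum_congr rfl fun x _ => ?_
          rw [sum_comm]
          refine sum_congr rfl fun z _ => sum_congr rfl fun y _ => sum_congr rfl fun z' _ => ?_
          rw [propext (h₂ x y z), propext (h₂ x y z'), propext (h₁ x z y), propext (h₁ x z' y)]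
      _ = S := by rw [sum_comm, e₁]
  calc ∑ x, ∑ y, ∑ z, resampleChange f T x y z
      ≤ S + S + S := by
        refine le_of_le_of_eq ?_ (congrArg₂ (· + ·) (congrArg₂ (· + ·) e₁ e₂) e₃)
        simp only [← sum_add_distrib]
        exact sum_le_sum fun x _ => sum_le_sum fun y _ => sum_le_sum fun z _ =>
          (resampleChange_le f T x y z).trans_eq (by simp only [sum_add_distrib])
    _ = 3 * S := by ring

end colorKernel

end ternary

theorem SimpleGraph.not_hasShattered_of_vcDimension_lt {V : Type*} {G : SimpleGraph V} {k : ℕ}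
    (h : G.vcDimension < (k : ℕ∞)) : ¬ G.HasShattered k := fun hk =>
  h.not_ge (le_iSup₂ (f := fun (d : ℕ) (_ : G.HasShattered d) => (d : ℕ∞)) k hk)

open Finset in
theorem Finpartition.card_parts_ofSetoid_ker_le {V C : Type*} [Fintype V] [DecidableEq V]
    [Fintype C] (f : V → C) [DecidableRel (Setoid.ker f).r] :
    (Finpartition.ofSetoid (Setoid.ker f)).parts.card ≤ Fintype.card C := by
  classical
  have hsub : (Finpartition.ofSetoid (Setoid.ker f)).parts ⊆
      univ.image fun c : C => univ.filter fun v => f v = c := by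
    intro p hp
    obtain ⟨x, hx⟩ := (Finpartition.ofSetoid (Setoid.ker f)).nonempty_of_mem_parts hp
    refine mem_image.2 ⟨f x, mem_univ _, ?_⟩
    rw [← (Finpartition.ofSetoid (Setoid.ker f)).part_eq_of_mem hp hx]
    ext v
    rw [Finpartition.mem_part_ofSetoid_iff_rel, Setoid.ker_def]
    simp [eq_comm]
  exact (card_le_card hsub).trans card_image_le

/-! ### From resampling to homogeneous partitions -/

namespace ThreeGraph

open Finset

variable {V : Type*} [DecidableEq V] (H : ThreeGraph V)

/-- The symmetric ternary relation of spanning an edge. -/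
def IsEdge (x y z : V) : Prop := ({x, y, z} : Finset V) ∈ H.edges

theorem isEdge_swap_left (x y z : V) : H.IsEdge x y z ↔ H.IsEdge y x z := by
  unfold IsEdge; rw [Finset.insert_comm]

theorem isEdge_swap_right (x y z : V) : H.IsEdge x y z ↔ H.IsEdge x z y := by
  unfold IsEdge; rw [Finset.pair_comm]

theorem slice_adj_iff (x y z : V) : (H.slice x).Adj y z ↔ H.IsEdge x y z := by
  refine ⟨fun h => h.2, fun h => ⟨?_, h⟩⟩
  rintro rfl
  have h₃ := H.card_eq_three _ h
  rw [Finset.pair_eq_singleton] at h₃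
  have := Finset.card_le_two (a := x) (b := y)
  omega

theorem not_relShatters_isEdge {k : ℕ} (h : H.slicewiseVC < (k : ℕ∞)) (x : V) :
    ¬ RelShatters (H.IsEdge x) k := by
  rintro ⟨a, b, hab⟩
  have hx : (H.slice x).vcDimension < (k : ℕ∞) :=
    (le_iSup (fun x => (H.slice x).vcDimension) x).trans_lt h
  refine SimpleGraph.not_hasShattered_of_vcDimension_lt hx ⟨a, b, fun i S => ?_⟩
  rw [slice_adj_iff, H.isEdge_swap_right]
  exact hab i S

theorem density_nonneg (X Y Z : Finset V) : 0 ≤ H.density X Y Z := by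
  unfold density; positivity

theorem density_le_one (X Y Z : Finset V) : H.density X Y Z ≤ 1 := by
  unfold density
  refine div_le_one_of_le₀ ?_ (by positivity)
  refine (Nat.cast_le.2 (card_filter_le _ _)).trans_eq ?_
  simp [card_product, mul_assoc]

theorem le_density_of_not_isHomogeneousTriple {ε : ℝ} {X Y Z : Finset V}
    (h : ¬ H.IsHomogeneousTriple ε X Y Z) :
    ε ≤ H.density X Y Z ∧ ε ≤ 1 - H.density X Y Z := by
  simp only [IsHomogeneousTriple, Set.mem_union, Set.mem_Ico, Set.mem_Ioc, not_or, not_and,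
    not_lt, not_le] at h
  refine ⟨h.1 (H.density_nonneg X Y Z), ?_⟩
  by_contra! hlt
  exact (h.2 (by linarith)).not_ge (H.density_le_one X Y Z)

variable [Fintype V] {C : Type*} [DecidableEq C] (f : V → C)

/-- The resampled triple is uniform on the product of the three color classes. -/
theorem sum_colorKernel_disagree_false (x y z : V) :
    ∑ x', colorKernel f x x' * ∑ y', colorKernel f y y' * ∑ z', colorKernel f z z' *
        disagree False (H.IsEdge x' y' z') =
      H.density (univ.filter fun w => f x = f w) (univ.filter fun w => f y = f w)
        (univ.filter fun w => f z = f w) := by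
  classical
  simp only [sum_colorKernel_mul, ← sum_div, div_div]
  unfold density
  congr 1
  · rw [card_filter, sum_product, Nat.cast_sum]
    refine sum_congr rfl fun x' _ => ?_
    rw [sum_product, Nat.cast_sum]
    refine sum_congr rfl fun y' _ => ?_
    rw [Nat.cast_sum]
    refine sum_congr rfl fun z' _ => ?_
    unfold disagree IsEdge
    by_cases h : ({x', y', z'} : Finset V) ∈ H.edges <;> simp [h]
  · ring

theorem sum_colorKernel_disagree_true (x y z : V) :
    ∑ x', colorKernel f x x' * ∑ y', colorKernel f y y' * ∑ z', colorKernel f z z' *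
        disagree True (H.IsEdge x' y' z') =
      1 - H.density (univ.filter fun w => f x = f w) (univ.filter fun w => f y = f w)
        (univ.filter fun w => f z = f w) := by
  have h (p : Prop) : disagree True p = 1 - disagree False p := by
    unfold disagree; by_cases p <;> simp [*]
  rw [← sum_colorKernel_disagree_false]
  simp only [h, mul_sub, sum_sub_distrib, mul_one, sum_colorKernel]

theorem le_resampleChange_of_not_isHomogeneousTriple {ε : ℝ} {x y z : V}
    (h : ¬ H.IsHomogeneousTriple ε (univ.filter fun w => f x = f w)
      (univ.filter fun w => f y = f w) (univ.filter fun w => f z = f w)) :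
    ε ≤ resampleChange f H.IsEdge x y z := by
  have h' := H.le_density_of_not_isHomogeneousTriple h
  unfold resampleChange
  by_cases hT : H.IsEdge x y z
  · simp only [hT, sum_colorKernel_disagree_true]
    exact h'.2
  · simp only [hT, sum_colorKernel_disagree_false]
    exact h'.1

/-- Markov's inequality: each uncovered triple contributes at least `ε` to the sum. -/
theorem isHomogeneousPartition_of_sum_resampleChange_le
    [DecidableRel (Setoid.ker f).r] {ε : ℝ} (hε : 0 < ε)
    (h : ∑ x, ∑ y, ∑ z, resampleChange f H.IsEdge x y z ≤ ε ^ 2 * (Fintype.card V : ℝ) ^ 3) :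
    H.IsHomogeneousPartition ε (Finpartition.ofSetoid (Setoid.ker f)) := by
  set P := Finpartition.ofSetoid (Setoid.ker f) with hP
  have hpart (x : V) : P.part x = univ.filter fun w => f x = f w := by
    ext w
    rw [hP, Finpartition.mem_part_ofSetoid_iff_rel, Setoid.ker_def]
    simp
  classical
  unfold IsHomogeneousPartition
  set G := univ.filter fun t : V × V × V => ∃ X ∈ P.parts, ∃ Y ∈ P.parts, ∃ Z ∈ P.parts,
    H.IsHomogeneousTriple ε X Y Z ∧ t.1 ∈ X ∧ t.2.1 ∈ Y ∧ t.2.2 ∈ Z with hG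
  have hbad : ε * (Gᶜ.card : ℝ) ≤ ε ^ 2 * (Fintype.card V : ℝ) ^ 3 := by
    calc ε * (Gᶜ.card : ℝ) = ∑ _t ∈ Gᶜ, ε := by rw [sum_const, nsmul_eq_mul, mul_comm]
      _ ≤ ∑ t ∈ Gᶜ, resampleChange f H.IsEdge t.1 t.2.1 t.2.2 := by
          refine sum_le_sum fun t ht => ?_
          refine H.le_resampleChange_of_not_isHomogeneousTriple f fun hom => ?_
          have hom' : H.IsHomogeneousTriple ε (P.part t.1) (P.part t.2.1) (P.part t.2.2) := by
            rw [hpart, hpart, hpart]; convert hom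
          refine mem_compl.1 ht (mem_filter.2 ⟨mem_univ _, P.part t.1, P.part_mem.2 (mem_univ _),
            P.part t.2.1, P.part_mem.2 (mem_univ _), P.part t.2.2, P.part_mem.2 (mem_univ _),
            hom', ?_, ?_, ?_⟩) <;> simp
      _ ≤ ∑ t : V × V × V, resampleChange f H.IsEdge t.1 t.2.1 t.2.2 :=
          sum_le_sum_of_subset_of_nonneg (subset_univ _)
            fun t _ _ => resampleChange_nonneg f _ _ _ _
      _ ≤ _ := by simpa only [Fintype.sum_prod_type] using h
  have hbad' : (Gᶜ.card : ℝ) ≤ ε * (Fintype.card V : ℝ) ^ 3 := by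
    refine le_of_mul_le_mul_left (hbad.trans_eq ?_) hε
    ring
  have htot : (G.card : ℝ) + Gᶜ.card = (Fintype.card V : ℝ) ^ 3 := by
    rw [← Nat.cast_add, card_add_card_compl]
    simp only [Fintype.card_prod]
    push_cast
    ring
  linarith

end ThreeGraph

/-! ### Choice of parameters -/

open Finset in
theorem theorem1p4 (k : ℕ) (hk : 1 ≤ k) :
    ∃ K : ℝ, 0 < K ∧ ∃ εstar : ℝ, 0 < εstar ∧
      ∀ ε : ℝ, 0 < ε → ε < εstar →
        ∃ N : ℕ, ∀ (V : Type*) [Fintype V] [DecidableEq V] (H : ThreeGraph V),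
          N ≤ Fintype.card V → H.slicewiseVC < (k : ℕ∞) →
            ∃ P : Finpartition (Finset.univ : Finset V),
              H.IsHomogeneousPartition ε P ∧
                (P.parts.card : ℝ) ≤ (2 : ℝ) ^ ((2 : ℝ) ^ (ε ^ (-K))) := by
  classical
  obtain ⟨L₀, hL₀⟩ := Filter.eventually_atTop.1 (eventually_sample_size k)
  -- `K = 24` is `3 * 8`, from `L ≤ ε⁻³` and the exponent `L ^ 8`. The 25 gives `24 / ε ^ 2 + 1 ≤ 25
  -- / ε ^ 2 ≤ ε⁻³`, and `L₀` gives `L₀ ≤ L`. `N = 1` only ensures that `V` is nonempty.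
  refine ⟨24, by norm_num, 1 / (L₀ + 25), by positivity, fun ε hε hε' => ⟨1, ?_⟩⟩
  intro V _ _ H hV hvc
  have : Nonempty V := Fintype.card_pos_iff.1 hV
  have hL₀' : (0 : ℝ) ≤ L₀ := Nat.cast_nonneg _
  have hεL : ε * (L₀ + 25) < 1 := by rwa [lt_div_iff₀ (by positivity)] at hε'
  have hε1 : ε * 25 < 1 := by nlinarith
  -- The total change is at most `3 * (4 + 2 * 2) / L = 24 / L` of all triples, and Markov needs
  -- this below `ε ^ 2`.
  set L := ⌈24 / ε ^ 2⌉₊ with hLdef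
  have hL1 : 24 / ε ^ 2 ≤ (L : ℝ) := Nat.le_ceil _
  have hL2 : (L : ℝ) < 24 / ε ^ 2 + 1 := Nat.ceil_lt_add_one (by positivity)
  have hLε : 24 ≤ L * ε ^ 2 := by rwa [div_le_iff₀ (by positivity)] at hL1
  have hLge : L₀ ≤ L := by
    have : (L₀ : ℝ) ≤ L := by
      refine le_trans ?_ hL1
      rw [le_div_iff₀ (by positivity)]
      nlinarith
    exact_mod_cast this
  have hLpos : 1 ≤ L := Nat.ceil_pos.2 (by positivity)
  have hL0 : (0 : ℝ) < L := by exact_mod_cast hLpos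
  obtain ⟨f, c, hc, hd⟩ := exists_coloring_sliceDist_le H.isEdge_swap_left H.isEdge_swap_right
    hk (H.not_relShatters_isEdge hvc) hLpos (hL₀ L hLge)
    (hL₀ (L ^ 3) (hLge.trans (Nat.le_self_pow (by norm_num) L)))
  refine ⟨Finpartition.ofSetoid (Setoid.ker f), ?_, ?_⟩
  · refine H.isHomogeneousPartition_of_sum_resampleChange_le f hε ?_
    refine (sum_resampleChange_le f H.isEdge_swap_left H.isEdge_swap_right).trans ?_
    have hW := sum_colorKernel_mul_sliceDist_le f (Nat.cast_nonneg (Fintype.card V)) hc hd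
    have h24 : 24 / (L : ℝ) ≤ ε ^ 2 := by rw [div_le_iff₀ hL0]; linarith
    calc _ ≤ 3 * ((Fintype.card V : ℝ) * (4 * Fintype.card V / L * Fintype.card V +
            2 * (2 * (Fintype.card V : ℝ) ^ 2 / L))) := by gcongr
      _ = 24 / (L : ℝ) * (Fintype.card V : ℝ) ^ 3 := by ring
      _ ≤ _ := by gcongr
  · have hparts : (Finpartition.ofSetoid (Setoid.ker f)).parts.card ≤ 2 ^ 2 ^ L ^ 8 := by
      refine (Finpartition.card_parts_ofSetoid_ker_le f).trans ?_
      rw [Fintype.card_finset, Fintype.card_prod, Fintype.card_fin, Fintype.card_fin,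
        show L ^ 2 * (L ^ 3) ^ 2 = L ^ 8 by ring]
      -- There are only `2 ^ L ^ 8` colors; the second exponential is slack.
      exact Nat.pow_le_pow_right (by norm_num) Nat.lt_two_pow_self.le
    have hLle : (L : ℝ) ≤ (ε ^ 3)⁻¹ := by
      refine hL2.le.trans ?_
      have h25 : 24 / ε ^ 2 + 1 ≤ 25 / ε ^ 2 := by
        rw [show (25 : ℝ) / ε ^ 2 = 24 / ε ^ 2 + 1 / ε ^ 2 by ring]
        gcongr
        rw [le_div_iff₀ (by positivity)]
        nlinarith
      refine h25.trans ?_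
      rw [div_le_iff₀ (by positivity), show (ε ^ 3)⁻¹ * ε ^ 2 = 1 / ε by field_simp,
        le_div_iff₀ hε]
      linarith
    have hpow : ((L ^ 8 : ℕ) : ℝ) ≤ ε ^ (-(24 : ℝ)) := by
      rw [Real.rpow_neg hε.le, show (24 : ℝ) = ((24 : ℕ) : ℝ) by norm_num, Real.rpow_natCast]
      push_cast
      calc (L : ℝ) ^ 8 ≤ ((ε ^ 3)⁻¹) ^ 8 := by gcongr
        _ = _ := by rw [inv_pow, ← pow_mul]
    calc ((Finpartition.ofSetoid (Setoid.ker f)).parts.card : ℝ)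
        ≤ ((2 ^ 2 ^ L ^ 8 : ℕ) : ℝ) := by exact_mod_cast hparts
      _ = (2 : ℝ) ^ ((2 : ℝ) ^ ((L ^ 8 : ℕ) : ℝ)) := by
          rw [Real.rpow_natCast 2 (L ^ 8), show ((2 : ℝ) ^ (L ^ 8)) = ((2 ^ L ^ 8 : ℕ) : ℝ) by
            push_cast; rfl, Real.rpow_natCast]
          push_cast
          rfl
      _ ≤ _ := by
          refine Real.rpow_le_rpow_of_exponent_le (by norm_num) ?_
          exact Real.rpow_le_rpow_of_exponent_le (by norm_num) hpow
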